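/- Theorem. Let $P$ be a (finite, square, real) stochastic matrix, i.e. $P$ has nonnegative entries and every row of $P$ sums to $1$. Suppose $P$ is strongly infinitely divisible, that is, $\det P > 0$ and for every integer $n \ge 1$ there is an entrywise nonnegative real matrix $K_n$, not necessarily stochastic, with $(K_n)^n = P$. Then $P$ is embeddable, that is, there is an intensity matrix $R$ (a real matrix with nonnegative off-diagonal entries all of whose row sums are $0$) such that $P = e^{R}$. -/

import Mathlib

namespace Matrix

variable {ι : Type*} [Fintype ι] [DecidableEq ι]

/-- A real square matrix `B` is infinitely divisible if it is (entrywise) nonnegative and there is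
a sequence `K 1, K 2, …` of (entrywise) nonnegative matrices with `K n ^ n = B` for all `n ≥ 1`.
The value `K 0` plays no role. -/
def InfinitelyDivisible (B : Matrix ι ι ℝ) : Prop :=
  (∀ i j, 0 ≤ B i j) ∧
    ∃ K : ℕ → Matrix ι ι ℝ, ∀ n : ℕ, 1 ≤ n → (∀ i j, 0 ≤ K n i j) ∧ K n ^ n = B

/-- An infinitely divisible matrix with positive determinant. -/
def StronglyInfinitelyDivisible (B : Matrix ι ι ℝ) : Prop :=
  InfinitelyDivisible B ∧ 0 < B.det

/-- An intensity matrix (generator of a finite-state continuous-time Markov chain): nonnegative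
off-diagonal entries and all row sums equal to zero. -/
def IsIntensity (R : Matrix ι ι ℝ) : Prop :=
  (∀ i j, i ≠ j → 0 ≤ R i j) ∧ ∀ i, ∑ j, R i j = 0

/-- `P` is embeddable if it is the exponential of an intensity matrix. -/
def Embeddable (P : Matrix ι ι ℝ) : Prop :=
  ∃ R : Matrix ι ι ℝ, IsIntensity R ∧ P = NormedSpace.exp R

end Matrix

/-! Let N be the order of the symmetric group on `ι`. A nonsingular nonnegative root K has a
permutation in its support, so K ^ N has positive diagonal; a maximum principle then forces this
power to be stochastic. Hence `P` has stochastic roots of every order. A subsequential limit of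
stochastic roots L of order N(k+1) has determinant of modulus one, so it is a permutation matrix.
The powers L ^ N are therefore roots of order k+1 tending, along that subsequence, to the identity.
Near the identity, |det L| ≤ exp(-t/2) with t the trace of 1 - L. As det L ^ n = det P > 0, this
bounds n(L - 1). Any limit point R is an intensity matrix, and L ^ n tends to exp R along the
subsequence, so P = exp R. -/

open Filter Topology Finset

/-! ### Powers near the identity and the exponential. -/

namespace NormedSpace

theorem norm_pow_sub_pow_le_of_norm_le {A : Type*} [NormedRing A] [NormOneClass A] {x y : A}
    {M : ℝ} (hM : 1 ≤ M) (hx : ‖x‖ ≤ M) (hy : ‖y‖ ≤ M) (n : ℕ) :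
    ‖x ^ n - y ^ n‖ ≤ n * M ^ n * ‖x - y‖ := by
  induction n with
  | zero => simp
  | succ n ih =>
    have hM0 : 0 ≤ M := zero_le_one.trans hM
    have e : x ^ (n + 1) - y ^ (n + 1) = x ^ n * (x - y) + (x ^ n - y ^ n) * y := by
      rw [pow_succ, pow_succ]; noncomm_ring
    have h1 : ‖x ^ n * (x - y)‖ ≤ M ^ (n + 1) * ‖x - y‖ := by
      refine (norm_mul_le _ _).trans ?_
      gcongr
      calc ‖x ^ n‖ ≤ ‖x‖ ^ n := norm_pow_le _ _
        _ ≤ M ^ n := by gcongr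
        _ ≤ M ^ (n + 1) := pow_le_pow_right₀ hM (Nat.le_succ n)
    have h2 : ‖(x ^ n - y ^ n) * y‖ ≤ n * M ^ n * ‖x - y‖ * M := by
      refine (norm_mul_le _ _).trans ?_
      gcongr
    rw [e]
    refine (norm_add_le _ _).trans ((add_le_add h1 h2).trans_eq ?_)
    push_cast
    ring

/-- If `n k • (L k - 1) → R` with `n k → ∞`, then `L k ^ n k → exp R`. -/
theorem tendsto_pow_exp_of_tendsto_smul_sub_one {A : Type*} [NormedRing A] [NormedAlgebra ℝ A]
    [CompleteSpace A] [NormOneClass A] {n : ℕ → ℕ} (hn : Tendsto n atTop atTop) {L : ℕ → A} {R : A}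
    (h : Tendsto (fun k => (n k : ℝ) • (L k - 1)) atTop (𝓝 R)) :
    Tendsto (fun k => L k ^ n k) atTop (𝓝 (exp R)) := by
  have hB : Tendsto (fun k => L k - 1) atTop (𝓝 0) := by
    have h1 : Tendsto (fun k => ((n k : ℝ))⁻¹) atTop (𝓝 0) :=
      tendsto_inv_atTop_zero.comp (tendsto_natCast_atTop_atTop.comp hn)
    have h2 := h1.smul h
    rw [zero_smul] at h2
    refine h2.congr' ?_
    filter_upwards [hn.eventually_ge_atTop 1] with k hk
    rw [smul_smul, inv_mul_cancel₀ (by positivity), one_smul]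
  -- The derivative of `exp` at 0 is the identity.
  have hlo : (fun k => exp (L k - 1) - L k) =o[atTop] fun k => L k - 1 := by
    have h0 := (hasFDerivAt_exp_zero (𝕂 := ℝ) (𝔸 := A)).isLittleO.comp_tendsto hB
    simpa [Function.comp_def, sub_sub] using h0
  have hlo' : Tendsto (fun k => (n k : ℝ) * ‖exp (L k - 1) - L k‖) atTop (𝓝 0) := by
    have h1 : (fun k => (n k : ℝ) • (exp (L k - 1) - L k)) =o[atTop]
        fun k => (n k : ℝ) • (L k - 1) := (Asymptotics.isBigO_refl _ _).smul_isLittleO hlo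
    have h2 := (h1.trans_isBigO (h.isBigO_one ℝ)).tendsto_zero_of_tendsto tendsto_const_nhds
    simpa [norm_smul] using h2.norm
  have hexp : Tendsto (fun k => exp (L k - 1) ^ n k) atTop (𝓝 (exp R)) := by
    let := NormedAlgebra.restrictScalars ℚ ℝ A
    have := ((exp_continuous (𝔸 := A)).tendsto R).comp h
    refine this.congr fun k => ?_
    rw [Function.comp_apply, ← exp_nsmul, Nat.cast_smul_eq_nsmul]
  have hnorm : Tendsto (fun k => Real.exp (2 * ‖(n k : ℝ) • (L k - 1)‖) *
      ((n k : ℝ) * ‖exp (L k - 1) - L k‖)) atTop (𝓝 0) := by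
    have := ((Real.continuous_exp.tendsto _).comp (h.norm.const_mul 2)).mul hlo'
    simpa using this
  have hdiff : Tendsto (fun k => L k ^ n k - exp (L k - 1) ^ n k) atTop (𝓝 0) := by
    refine squeeze_zero_norm' ?_ hnorm
    filter_upwards [hlo.bound one_pos] with k hk
    have e1 : ‖L k‖ ≤ 1 + ‖L k - 1‖ := by
      simpa using norm_add_le (1 : A) (L k - 1)
    have e2 : ‖exp (L k - 1)‖ ≤ 1 + 2 * ‖L k - 1‖ := by
      have := norm_add_le (exp (L k - 1) - L k) (L k)
      rw [sub_add_cancel] at this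
      linarith
    have e3 := Real.add_one_le_exp (2 * ‖L k - 1‖)
    have e4 := norm_nonneg (L k - 1)
    -- This `M` is chosen because its `n k`-th power is exp(2‖n(L - 1)‖), which stays bounded.
    have := norm_pow_sub_pow_le_of_norm_le (M := Real.exp (2 * ‖L k - 1‖))
      (Real.one_le_exp (by positivity)) (e1.trans (by linarith)) (e2.trans (by linarith)) (n k)
    refine this.trans_eq ?_
    rw [← Real.exp_nat_mul, norm_smul, Real.norm_natCast, norm_sub_rev (L k) (exp _),
      mul_left_comm (2 : ℝ)]
    ring
  simpa using hdiff.add hexp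

end NormedSpace

/-! ### Nonnegative and stochastic roots. -/

namespace Matrix

variable {ι : Type*}

theorem tendsto_apply {x : ℕ → Matrix ι ι ℝ} {R : Matrix ι ι ℝ} (h : Tendsto x atTop (𝓝 R))
    (i j : ι) : Tendsto (fun k => x k i j) atTop (𝓝 (R i j)) :=
  ((continuous_id.matrix_elem i j).tendsto R).comp h

variable [Fintype ι]

theorem mul_apply_le_mul_apply {A B : Matrix ι ι ℝ} (hA : ∀ i j, 0 ≤ A i j)
    (hB : ∀ i j, 0 ≤ B i j) (i k j : ι) : A i k * B k j ≤ (A * B) i j :=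
  single_le_sum (f := fun k => A i k * B k j) (fun k _ => mul_nonneg (hA i k) (hB k j)) (mem_univ k)

theorem exists_tendsto_subseq_of_frequently_abs_le {x : ℕ → Matrix ι ι ℝ} {c : ℝ}
    (h : ∃ᶠ k in atTop, ∀ i j, |x k i j| ≤ c) :
    ∃ (R : Matrix ι ι ℝ) (φ : ℕ → ℕ), StrictMono φ ∧ Tendsto (x ∘ φ) atTop (𝓝 R) := by
  have hc : IsCompact (Set.univ.pi fun _ : ι => Set.univ.pi fun _ : ι => Set.Icc (-c) c) :=
    isCompact_univ_pi fun _ => isCompact_univ_pi fun _ => isCompact_Icc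
  obtain ⟨R, -, φ, hφ, hR⟩ := hc.tendsto_subseq' (X := ι → ι → ℝ) (x := x)
    (h.mono fun k hk i _ j _ => abs_le.1 (hk i j))
  exact ⟨R, φ, hφ, hR⟩

variable [DecidableEq ι]

theorem pow_le_pow_apply_perm {A : Matrix ι ι ℝ} (hA : ∀ i j, 0 ≤ A i j) {c : ℝ} (hc : 0 ≤ c)
    (σ : Equiv.Perm ι) (h : ∀ i, c ≤ A i (σ i)) (n : ℕ) (i : ι) : c ^ n ≤ (A ^ n) i ((σ ^ n) i) := by
  induction n with
  | zero => simp
  | succ n ih =>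
    rw [pow_succ, pow_succ, pow_succ', Equiv.Perm.mul_apply]
    refine le_trans ?_ (mul_apply_le_mul_apply (pow_apply_nonneg hA n) hA i ((σ ^ n) i) _)
    exact mul_le_mul ih (h _) hc (pow_apply_nonneg hA n _ _)

theorem exists_perm_forall_ne_zero {A : Matrix ι ι ℝ} (hdet : A.det ≠ 0) :
    ∃ σ : Equiv.Perm ι, ∀ i, A i (σ i) ≠ 0 := by
  by_contra! h
  refine hdet ?_
  rw [← det_transpose, det_apply]
  refine sum_eq_zero fun σ _ => ?_
  obtain ⟨i, hi⟩ := h σ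
  rw [prod_eq_zero (mem_univ i) (by simpa using hi), smul_zero]

/-- A nonsingular nonnegative matrix raised to the order of the symmetric group has a positive
diagonal. -/
theorem pow_card_perm_diag_pos [Nonempty ι] {A : Matrix ι ι ℝ} (hA : ∀ i j, 0 ≤ A i j)
    (hdet : A.det ≠ 0) (i : ι) : 0 < (A ^ Fintype.card (Equiv.Perm ι)) i i := by
  obtain ⟨σ, hσ⟩ := exists_perm_forall_ne_zero hdet
  obtain ⟨i₀, hi₀⟩ := Finite.exists_min fun i => A i (σ i)
  have hpos : 0 < A i₀ (σ i₀) := (hA _ _).lt_of_ne' (hσ i₀)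
  have := pow_le_pow_apply_perm hA hpos.le σ hi₀ (Fintype.card (Equiv.Perm ι)) i
  rw [pow_card_eq_one, Equiv.Perm.one_apply] at this
  exact (pow_pos hpos _).trans_le this

/-- A walk can step from `i` to `j` and then idle at `j`. -/
theorem pow_succ_apply_pos {A : Matrix ι ι ℝ} (hA : ∀ i j, 0 ≤ A i j) (hd : ∀ i, 0 < A i i)
    {i j : ι} (hij : 0 < A i j) (n : ℕ) : 0 < (A ^ (n + 1)) i j := by
  induction n with
  | zero => simpa using hij
  | succ n ih =>
    rw [pow_succ]
    exact (mul_pos ih (hd j)).trans_le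
      (mul_apply_le_mul_apply (pow_apply_nonneg hA _) hA i j j)

/-- The maximum principle for harmonic functions of a stochastic matrix. -/
theorem eq_of_mulVec_eq_of_forall_le {P : Matrix ι ι ℝ} (hP : P ∈ rowStochastic ℝ ι) {w : ι → ℝ}
    (hw : P *ᵥ w = w) {i j : ι} (hi : ∀ k, w k ≤ w i) (hij : 0 < P i j) : w j = w i := by
  have h0 : ∑ k, P i k * (w i - w k) = 0 := by
    have := congrFun hw i
    simp only [mulVec, dotProduct] at this
    simp only [mul_sub, sum_sub_distrib, ← sum_mul, sum_row_of_mem_rowStochastic hP, this]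
    ring
  have h1 := (sum_eq_zero_iff_of_nonneg fun k _ =>
    mul_nonneg (nonneg_of_mem_rowStochastic hP) (sub_nonneg.2 (hi k))).1 h0 j (mem_univ j)
  rcases mul_eq_zero.1 h1 with h | h
  · exact absurd h hij.ne'
  · linarith

/-- A nonnegative root with positive diagonal of a stochastic matrix is stochastic. -/
theorem mem_rowStochastic_of_pow {A : Matrix ι ι ℝ} (hA : ∀ i j, 0 ≤ A i j) (hd : ∀ i, 0 < A i i)
    {n : ℕ} (hn : n ≠ 0) (hP : A ^ n ∈ rowStochastic ℝ ι) : A ∈ rowStochastic ℝ ι := by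
  refine mem_rowStochastic.2 ⟨hA, ?_⟩
  rcases isEmpty_or_nonempty ι with _ | _
  · exact Subsingleton.elim _ _
  set w : ι → ℝ := A *ᵥ 1 with hwdef
  have hw : A ^ n *ᵥ w = w := by
    rw [hwdef, mulVec_mulVec, ← pow_succ, pow_succ', ← mulVec_mulVec,
      one_vecMul_of_mem_rowStochastic hP]
  have hw0 : ∀ i, 0 ≤ w i := fun i =>
    sum_nonneg fun k _ => mul_nonneg (hA i k) zero_le_one
  -- If the level set of `w` through `i₀` is closed under `A ^ n`, it is closed under `A`, whose
  -- support lies in that of `A ^ n`. On it `A` has constant row sum `w i₀`, so `w i₀ ^ n = 1`.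
  have key : ∀ i₀, (∀ i j, w i = w i₀ → 0 < (A ^ n) i j → w j = w i₀) → w i₀ = 1 := by
    intro i₀ hcl
    have hk : ∀ k i, w i = w i₀ → ((A ^ k) *ᵥ 1) i = w i₀ ^ k := by
      intro k
      induction k with
      | zero => simp
      | succ k ih =>
        intro i hi
        rw [pow_succ', ← mulVec_mulVec]
        have : (A *ᵥ (A ^ k *ᵥ 1)) i = ∑ j, A i j * w i₀ ^ k := by
          refine sum_congr rfl fun j _ => ?_
          rcases (hA i j).eq_or_lt with h | h
          · simp [← h]
          · obtain ⟨m, rfl⟩ := Nat.exists_eq_succ_of_ne_zero hn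
            rw [ih j (hcl i j hi (pow_succ_apply_pos hA hd h m))]
        rw [this, ← sum_mul, pow_succ', ← hi]
        simp [hwdef, mulVec, dotProduct]
    have h1 := hk n i₀ rfl
    rw [one_vecMul_of_mem_rowStochastic hP, Pi.one_apply] at h1
    exact (pow_eq_one_iff_of_nonneg (hw0 i₀) hn).1 h1.symm
  obtain ⟨a, ha⟩ := Finite.exists_max w
  obtain ⟨b, hb⟩ := Finite.exists_min w
  have ha1 : w a = 1 := key a fun i j hi hij =>
    (eq_of_mulVec_eq_of_forall_le hP hw (fun k => (ha k).trans hi.ge) hij).trans hi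
  have hb1 : w b = 1 := key b fun i j hi hij => by
    have := eq_of_mulVec_eq_of_forall_le hP (w := -w) (by rw [mulVec_neg, hw])
      (fun k => neg_le_neg (hi.le.trans (hb k))) hij
    exact (neg_injective this).trans hi
  funext i
  exact le_antisymm ((ha i).trans_eq ha1) (hb1.symm.le.trans (hb i))

/-! ### Determinants of stochastic matrices. -/

theorem abs_det_le_sum_prod {A : Matrix ι ι ℝ} (hA : ∀ i j, 0 ≤ A i j) :
    |A.det| ≤ ∑ σ : Equiv.Perm ι, ∏ i, A i (σ i) := by
  rw [← det_transpose, det_apply']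
  refine (abs_sum_le_sum_abs _ _).trans (sum_le_sum fun σ _ => ?_)
  rw [abs_mul, abs_prod]
  have : |(((Equiv.Perm.sign σ : ℤˣ) : ℤ) : ℝ)| = 1 := by
    rcases Int.units_eq_one_or (Equiv.Perm.sign σ) with h | h <;> simp [h]
  rw [this, one_mul]
  exact (prod_congr rfl fun i _ => abs_of_nonneg (hA i (σ i))).le

theorem sum_prod_apply_eq_one {A : Matrix ι ι ℝ} (hA : A ∈ rowStochastic ℝ ι) :
    ∑ f : ι → ι, ∏ i, A i (f i) = 1 := by
  have := prod_univ_sum (fun _ : ι => (univ : Finset ι)) fun i j => A i j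
  rw [Fintype.piFinset_univ] at this
  rw [← this]
  exact prod_eq_one fun i _ => sum_row_of_mem_rowStochastic hA i

/-- The products over all self-maps of `ι` sum to 1, and those over permutations already dominate
|det A|. -/
theorem abs_det_add_prod_le_one {A : Matrix ι ι ℝ} (hA : A ∈ rowStochastic ℝ ι) {f : ι → ι}
    (hf : ¬ Function.Injective f) : |A.det| + ∏ i, A i (f i) ≤ 1 := by
  have hinj : Function.Injective fun (σ : Equiv.Perm ι) => (σ : ι → ι) := DFunLike.coe_injective
  have hmem : f ∉ univ.map ⟨_, hinj⟩ := by
    simp only [Finset.mem_map, mem_univ, true_and, not_exists]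
    rintro σ rfl
    exact hf σ.injective
  rw [← sum_prod_apply_eq_one hA]
  calc |A.det| + ∏ i, A i (f i)
      ≤ (∑ σ : Equiv.Perm ι, ∏ i, A i (σ i)) + ∏ i, A i (f i) := by
        gcongr; exact abs_det_le_sum_prod hA.1
    _ = ∑ g ∈ (univ.map ⟨_, hinj⟩).cons f hmem, ∏ i, A i (g i) := by
        rw [sum_cons, sum_map, add_comm]; rfl
    _ ≤ _ := sum_le_sum_of_subset_of_nonneg (subset_univ _)
        fun g _ _ => prod_nonneg fun i _ => hA.1 _ _

theorem eq_one_of_mem_rowStochastic_of_diag {A : Matrix ι ι ℝ} (hA : A ∈ rowStochastic ℝ ι)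
    (hd : ∀ i, 1 ≤ A i i) : A = 1 := by
  ext i j
  have hi : A i i = 1 := le_antisymm (le_one_of_mem_rowStochastic hA) (hd i)
  rcases eq_or_ne i j with rfl | hij
  · rw [one_apply_eq, hi]
  · rw [one_apply_ne hij]
    have h1 := sum_row_of_mem_rowStochastic hA i
    rw [← add_sum_erase _ _ (mem_univ i), hi, add_eq_left] at h1
    exact (sum_eq_zero_iff_of_nonneg fun k _ => hA.1 i k).1 h1 j (by simp [hij.symm])

/-- A stochastic matrix whose determinant has absolute value one is a permutation matrix, so it
has finite order. -/
theorem pow_card_perm_eq_one_of_abs_det {A : Matrix ι ι ℝ} (hA : A ∈ rowStochastic ℝ ι)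
    (hdet : |A.det| = 1) : A ^ Fintype.card (Equiv.Perm ι) = 1 := by
  obtain ⟨σ, hσ⟩ := exists_perm_forall_ne_zero (A := A) fun h => by simp [h] at hdet
  have hz : ∀ i j, j ≠ σ i → A i j = 0 := by
    intro i j hj
    -- Redirecting `σ` at `i` alone makes `i` collide with `σ.symm j`.
    have hninj : ¬ Function.Injective (Function.update σ i j) := by
      intro hinj
      have hne : σ.symm j ≠ i := by
        rintro rfl
        simp at hj
      refine hne (hinj ?_)
      rw [Function.update_self, Function.update_of_ne hne, Equiv.apply_symm_apply]
    have h1 := abs_det_add_prod_le_one hA hninj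
    have h2 : 0 ≤ ∏ k, A k (Function.update σ i j k) := prod_nonneg fun k _ => hA.1 _ _
    have h3 : ∏ k, A k (Function.update σ i j k) = 0 := by linarith
    obtain ⟨k, -, hk⟩ := prod_eq_zero_iff.1 h3
    rcases eq_or_ne k i with rfl | hki
    · rwa [Function.update_self] at hk
    · rw [Function.update_of_ne hki] at hk
      exact absurd hk (hσ k)
  have h1 : ∀ i, 1 ≤ A i (σ i) := fun i => by
    rw [← sum_row_of_mem_rowStochastic hA i, sum_eq_single (σ i) (fun j _ hj => hz i j hj) (by simp)]
  refine eq_one_of_mem_rowStochastic_of_diag (pow_mem hA _) fun i => ?_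
  have := pow_le_pow_apply_perm hA.1 zero_le_one σ h1 (Fintype.card (Equiv.Perm ι)) i
  rwa [pow_card_eq_one, one_pow] at this

theorem one_sub_diag_le_sum {A : Matrix ι ι ℝ} (hA : A ∈ rowStochastic ℝ ι) (i : ι) :
    1 - A i i ≤ ∑ k, (1 - A k k) :=
  single_le_sum (f := fun k => 1 - A k k)
    (fun _ _ => sub_nonneg.2 (le_one_of_mem_rowStochastic hA)) (mem_univ i)

theorem apply_le_sum_one_sub_diag {A : Matrix ι ι ℝ} (hA : A ∈ rowStochastic ℝ ι) {i j : ι}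
    (hij : i ≠ j) : A i j ≤ ∑ k, (1 - A k k) := by
  refine le_trans ?_ (one_sub_diag_le_sum hA i)
  have h1 := sum_row_of_mem_rowStochastic hA i
  rw [← add_sum_erase _ _ (mem_univ i)] at h1
  have h2 : A i j ≤ ∑ k ∈ univ.erase i, A i k :=
    single_le_sum (f := fun k => A i k) (fun k _ => hA.1 i k) (by simp [hij.symm])
  linarith

theorem abs_sub_one_apply_le {A : Matrix ι ι ℝ} (hA : A ∈ rowStochastic ℝ ι) (i j : ι) :
    |(A - 1) i j| ≤ ∑ k, (1 - A k k) := by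
  rcases eq_or_ne i j with rfl | hij
  · rw [sub_apply, one_apply_eq, abs_sub_comm,
      abs_of_nonneg (sub_nonneg.2 (le_one_of_mem_rowStochastic hA))]
    exact one_sub_diag_le_sum hA i
  · rw [sub_apply, one_apply_ne hij, sub_zero, abs_of_nonneg (hA.1 i j)]
    exact apply_le_sum_one_sub_diag hA hij

/-- The identity permutation contributes the exponential. Any other one moves some `i`, hence also
`σ i`, giving two off-diagonal factors of size at most t. -/
theorem abs_det_le_exp_add {A : Matrix ι ι ℝ} (hA : A ∈ rowStochastic ℝ ι) :
    |A.det| ≤ Real.exp (-∑ k, (1 - A k k)) +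
      Fintype.card (Equiv.Perm ι) * (∑ k, (1 - A k k)) ^ 2 := by
  set t := ∑ k, (1 - A k k) with ht
  refine (abs_det_le_sum_prod hA.1).trans ?_
  rw [← add_sum_erase _ _ (mem_univ 1)]
  refine add_le_add ?_ ?_
  · rw [ht, ← sum_neg_distrib, Real.exp_sum]
    refine prod_le_prod (fun i _ => hA.1 _ _) fun i _ => ?_
    have := Real.add_one_le_exp (-(1 - A i i))
    rw [Equiv.Perm.one_apply]
    linarith
  · have hcard : ((univ.erase (1 : Equiv.Perm ι)).card : ℝ) ≤ Fintype.card (Equiv.Perm ι) := by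
      exact_mod_cast card_le_univ _
    refine le_trans (sum_le_card_nsmul _ _ (t ^ 2) fun σ hσ => ?_) ?_
    · obtain ⟨i, hi⟩ : ∃ i, σ i ≠ i := by
        by_contra! h
        exact (mem_erase.1 hσ).1 (Equiv.ext h)
      have hj : σ i ∈ univ.erase i := by simp [hi]
      rw [← mul_prod_erase _ _ (mem_univ i), ← mul_prod_erase _ _ hj, ← mul_assoc, sq]
      have h1 := apply_le_sum_one_sub_diag hA hi.symm
      have h2 := apply_le_sum_one_sub_diag hA (i := σ i) (j := σ (σ i))
        fun h => hi (σ.injective h.symm)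
      have ht0 := (hA.1 i (σ i)).trans h1
      refine (mul_le_of_le_one_right (mul_nonneg (hA.1 _ _) (hA.1 _ _)) ?_).trans
        (mul_le_mul h1 h2 (hA.1 _ _) ht0)
      exact prod_le_one (fun k _ => hA.1 _ _) fun k _ => le_one_of_mem_rowStochastic hA
    · rw [nsmul_eq_mul]
      gcongr

/-- With D the number of permutations, exp(-t) ≤ 1 - t + t² gives |det A| ≤ 1 - t + (1 + D)t² ≤ 1 -
t/2. -/
theorem abs_det_le_exp_neg_half {A : Matrix ι ι ℝ} (hA : A ∈ rowStochastic ℝ ι)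
    (ht : (1 + Fintype.card (Equiv.Perm ι)) * ∑ k, (1 - A k k) ≤ 1 / 2) :
    |A.det| ≤ Real.exp (-(∑ k, (1 - A k k)) / 2) := by
  have h := abs_det_le_exp_add hA
  have ht0 : 0 ≤ ∑ k, (1 - A k k) :=
    sum_nonneg fun _ _ => sub_nonneg.2 (le_one_of_mem_rowStochastic hA)
  set t := ∑ k, (1 - A k k)
  set D : ℝ := (Fintype.card (Equiv.Perm ι) : ℝ)
  have hD : 0 ≤ D := Nat.cast_nonneg _
  have h1 : |Real.exp (-t) - 1 - -t| ≤ (-t) ^ 2 :=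
    Real.abs_exp_sub_one_sub_id_le (by rw [abs_neg, abs_of_nonneg ht0]; nlinarith)
  have h2 := (abs_le.1 h1).2
  have h3 := Real.add_one_le_exp (-t / 2)
  have h4 := mul_le_mul_of_nonneg_right ht ht0
  nlinarith

/-! ### Limits of stochastic roots and the generator. -/

theorem mem_rowStochastic_of_tendsto {x : ℕ → Matrix ι ι ℝ} {R : Matrix ι ι ℝ}
    (h : Tendsto x atTop (𝓝 R)) (hx : ∀ k, x k ∈ rowStochastic ℝ ι) : R ∈ rowStochastic ℝ ι := by
  refine mem_rowStochastic_iff_sum.2 ⟨fun i j => ge_of_tendsto' (tendsto_apply h i j)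
    fun k => (hx k).1 i j, fun i => ?_⟩
  refine tendsto_nhds_unique (tendsto_finsetSum _ fun j _ => tendsto_apply h i j) ?_
  simp only [sum_row_of_mem_rowStochastic (hx _), tendsto_const_nhds]

/-- Stochastic roots of `P` of orders tending to infinity that converge to the identity yield a
generator of `P`. -/
theorem embeddable_of_tendsto_one [Nonempty ι] {P : Matrix ι ι ℝ} (hdet : 0 < P.det)
    {n : ℕ → ℕ} (hn : Tendsto n atTop atTop) {L : ℕ → Matrix ι ι ℝ}
    (hL : ∀ k, L k ∈ rowStochastic ℝ ι) (hpow : ∀ k, L k ^ n k = P)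
    (hlim : Tendsto L atTop (𝓝 1)) : Embeddable P := by
  have ht : Tendsto (fun k => (1 + Fintype.card (Equiv.Perm ι)) * ∑ i, (1 - L k i i))
      atTop (𝓝 0) := by
    have h1 : Tendsto (fun k => ∑ i, (1 - L k i i)) atTop (𝓝 (∑ i : ι, (1 - (1 : ℝ)))) :=
      tendsto_finsetSum _ fun i _ => tendsto_const_nhds.sub
        (by simpa using tendsto_apply hlim i i)
    simpa using h1.const_mul (1 + (Fintype.card (Equiv.Perm ι) : ℝ))
  have hbound : ∀ᶠ k in atTop, ∀ i j,
      |((n k : ℝ) • (L k - 1)) i j| ≤ -2 * Real.log P.det := by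
    filter_upwards [ht.eventually_le_const (show (0 : ℝ) < 1 / 2 by norm_num)] with k hk i j
    have h1 : P.det ≤ Real.exp (n k * (-(∑ i, (1 - L k i i)) / 2)) := by
      rw [Real.exp_nat_mul]
      calc P.det = |P.det| := (abs_of_pos hdet).symm
        _ = |(L k).det| ^ n k := by rw [← hpow k, det_pow, abs_pow]
        _ ≤ _ := pow_le_pow_left₀ (abs_nonneg _) (abs_det_le_exp_neg_half (hL k) hk) _
    have h2 := (Real.log_le_iff_le_exp hdet).2 h1
    rw [smul_apply, smul_eq_mul, abs_mul, Nat.abs_cast]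
    have h3 := mul_le_mul_of_nonneg_left (abs_sub_one_apply_le (hL k) i j) (n k).cast_nonneg (α := ℝ)
    linarith
  obtain ⟨R, φ, hφ, hR⟩ := exists_tendsto_subseq_of_frequently_abs_le hbound.frequently
  refine ⟨R, ⟨fun i j hij => ge_of_tendsto' (tendsto_apply hR i j) fun k => ?_, fun i => ?_⟩, ?_⟩
  · simp only [Function.comp_apply, smul_apply, sub_apply, one_apply_ne hij, sub_zero, smul_eq_mul]
    exact mul_nonneg (Nat.cast_nonneg _) ((hL _).1 i j)
  · refine tendsto_nhds_unique (tendsto_finsetSum _ fun j _ => tendsto_apply hR i j) ?_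
    have : ∀ k, ∑ j, ((n k : ℝ) • (L k - 1)) i j = 0 := fun k => by
      simp [← mul_sum, sum_row_of_mem_rowStochastic (hL k), one_apply]
    simp only [Function.comp_apply, this, tendsto_const_nhds]
  -- The row-sum operator norm is submultiplicative with ‖1‖ = 1, `ι` being nonempty.
  · let := Matrix.linftyOpNormedRing (n := ι) (α := ℝ)
    let := Matrix.linftyOpNormedAlgebra (n := ι) (R := ℝ) (α := ℝ)
    have h := NormedSpace.tendsto_pow_exp_of_tendsto_smul_sub_one (A := Matrix ι ι ℝ)
      (n := n ∘ φ) (L := L ∘ φ) (hn.comp hφ.tendsto_atTop) hR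
    simp only [Function.comp_apply, hpow] at h
    exact tendsto_nhds_unique tendsto_const_nhds h

/-- Limits of stochastic roots of `P` of orders tending to infinity have determinant `± 1`. -/
theorem abs_det_eq_one_of_tendsto {P Q : Matrix ι ι ℝ} (hdet : 0 < P.det) {n : ℕ → ℕ}
    (hn : Tendsto n atTop atTop) {L : ℕ → Matrix ι ι ℝ} (hpow : ∀ k, L k ^ n k = P)
    (hlim : Tendsto L atTop (𝓝 Q)) : |Q.det| = 1 := by
  have h1 : Tendsto (fun k => |(L k).det|) atTop (𝓝 |Q.det|) :=
    (((continuous_id.matrix_det).abs).tendsto Q).comp hlim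
  have h2 : Tendsto (fun k => P.det ^ ((n k : ℝ)⁻¹)) atTop (𝓝 (P.det ^ (0 : ℝ))) :=
    tendsto_const_nhds.rpow
      (tendsto_inv_atTop_zero.comp (tendsto_natCast_atTop_atTop.comp hn)) (Or.inl hdet.ne')
  rw [Real.rpow_zero] at h2
  refine tendsto_nhds_unique (h1.congr' ?_) h2
  filter_upwards [hn.eventually_ge_atTop 1] with k hk
  have : P.det = |(L k).det| ^ n k := by
    rw [← abs_pow, ← det_pow, hpow, abs_of_pos hdet]
  rw [this, Real.pow_rpow_inv_natCast (abs_nonneg _) (by omega)]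

/-- A nonsingular stochastic matrix with nonnegative roots of all orders has stochastic roots of
all orders. -/
theorem exists_rowStochastic_root [Nonempty ι] {P : Matrix ι ι ℝ} (hP : P ∈ rowStochastic ℝ ι)
    (hdiv : StronglyInfinitelyDivisible P) {n : ℕ} (hn : n ≠ 0) :
    ∃ L ∈ rowStochastic ℝ ι, L ^ n = P := by
  obtain ⟨⟨-, K, hK⟩, hdet⟩ := hdiv
  -- The extra factor is spent on making the diagonal of the root positive.
  have hN : Fintype.card (Equiv.Perm ι) * n ≠ 0 := mul_ne_zero Fintype.card_ne_zero hn
  obtain ⟨hK0, hKP⟩ := hK _ (Nat.one_le_iff_ne_zero.2 hN)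
  have hKdet : (K (Fintype.card (Equiv.Perm ι) * n)).det ≠ 0 := fun h => by
    rw [← hKP, det_pow, h, zero_pow hN] at hdet
    exact hdet.false
  rw [pow_mul] at hKP
  exact ⟨_, mem_rowStochastic_of_pow (pow_apply_nonneg hK0 _) (pow_card_perm_diag_pos hK0 hKdet) hn
    (hKP ▸ hP), hKP⟩

theorem embeddable_of_nonempty [Nonempty ι] {P : Matrix ι ι ℝ} (hP : P ∈ rowStochastic ℝ ι) (hdiv : StronglyInfinitelyDivisible P) :
    Embeddable P := by
  set N := Fintype.card (Equiv.Perm ι) with hN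
  have hN0 : N ≠ 0 := Fintype.card_ne_zero
  -- Here the factor `N` serves to turn the limiting permutation matrix into the identity.
  choose L hL hLP using fun k : ℕ =>
    exists_rowStochastic_root hP hdiv (mul_ne_zero hN0 k.succ_ne_zero)
  obtain ⟨Q, φ, hφ, hQ⟩ := exists_tendsto_subseq_of_frequently_abs_le (x := L) (c := 1)
    (Frequently.of_forall fun k i j => by
      rw [abs_of_nonneg ((hL k).1 i j)]; exact le_one_of_mem_rowStochastic (hL k))
  have hn : Tendsto (fun k => (φ k).succ) atTop atTop :=
    (tendsto_add_atTop_nat 1).comp hφ.tendsto_atTop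
  have hQdet : |Q.det| = 1 := abs_det_eq_one_of_tendsto hdiv.2
    (hn.const_mul_atTop' (Nat.pos_of_ne_zero hN0)) (fun k => hLP (φ k)) hQ
  have hQN : Q ^ N = 1 := pow_card_perm_eq_one_of_abs_det
    (mem_rowStochastic_of_tendsto hQ fun k => hL (φ k)) hQdet
  exact embeddable_of_tendsto_one hdiv.2 hn (L := fun k => L (φ k) ^ N)
    (fun k => pow_mem (hL _) _) (fun k => by rw [← pow_mul, hLP]) (hQN ▸ hQ.pow N)

end Matrix

theorem mainTheorem6 {ι : Type*} [Fintype ι] [DecidableEq ι] (P : Matrix ι ι ℝ)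
    (hP : P ∈ Matrix.rowStochastic ℝ ι) (hdiv : Matrix.StronglyInfinitelyDivisible P) :
    Matrix.Embeddable P := by
  rcases isEmpty_or_nonempty ι with _ | _
  · exact ⟨0, ⟨fun i => isEmptyElim i, fun i => isEmptyElim i⟩, Subsingleton.elim _ _⟩
  · exact Matrix.embeddable_of_nonempty hP hdiv
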